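/- Let $H$ be a complex Hilbert space, let $T$ be a bounded linear operator on $H$, and let $|T|=(T^*T)^{1/2}$. Let $T=U|T|$ be the polar decomposition of $T$, where $U$ is the partial isometry with $\ker U=\ker T$. Let $w(S)=\sup\{|\langle Sx,x\rangle| : x\in H,\ \|x\|=1\}$ denote the numerical radius of a bounded linear operator $S$ on $H$ (with $w(0)=0$ if $H=\{0\}$). For $0\le t\le 1$ put $$\widetilde{T_t}=|T|^{t}\,U\,|T|^{1-t},\qquad P_t=|T|^{2(1-t)}+|T|^{2t},$$ where powers of $|T|$ are taken in the continuous functional calculus, so that $|T|^0=I$. Then, for every $t\in[0,1]$, $$w(T)\ \le\ \sqrt{\tfrac1{16}\|P_t\|^2+\tfrac14 w^2(\widetilde{T_t})+\tfrac18 w\big(\widetilde{T_t}P_t+P_t\widetilde{T_t}\big)}\ \le\ \tfrac14\|P_t\|+\tfrac12 w(\widetilde{T_t}).$$ In particular, for $t=\tfrac12$ and $\widetilde T=\widetilde{T_{1/2}}=|T|^{1/2}U|T|^{1/2}$, $$w(T)\ \le\ \sqrt{\tfrac14\|T\|^2+\tfrac14 w^2(\widetilde T)+\tfrac14 w\big(\widetilde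 T|T|+|T|\widetilde T\big)}\ \le\ \tfrac12\|T\|+\tfrac12 w(\widetilde T).$$ -/

import Mathlib

section NumericalRadiusDefs

variable {H : Type*} [NormedAddCommGroup H] [InnerProductSpace ℂ H]

/-- The numerical radius `w(T) = sup { |⟨T x, x⟩| : ‖x‖ = 1 }`. The set is bounded above by `‖T‖`;
on the zero space it is empty and the value is `0`. -/
noncomputable def numericalRadius (T : H →L[ℂ] H) : ℝ :=
  sSup {r : ℝ | ∃ x : H, ‖x‖ = 1 ∧ r = ‖inner ℂ (T x) x‖}

variable [CompleteSpace H]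

/-- `T = U |T|` is the polar decomposition of `T`: the factor `U` is a partial isometry
(it is isometric on the orthogonal complement of its kernel), and it has the same kernel as `T`.
Here `|T| = (T* T)^(1/2)` is `CFC.abs T`. -/
structure IsPolarDecomposition (T U : H →L[ℂ] H) : Prop where
  mul_abs : U * CFC.abs T = T
  norm_map : ∀ x ∈ (LinearMap.ker U.toLinearMap)ᗮ, ‖U x‖ = ‖x‖
  ker_eq : LinearMap.ker U.toLinearMap = LinearMap.ker T.toLinearMap

/-- The operators `|T|` and `T` have the same norm at every vector. -/
theorem norm_cfcAbs_apply (T : H →L[ℂ] H) (x : H) : ‖CFC.abs T x‖ = ‖T x‖ := by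
  have hsa : star (CFC.abs T) = CFC.abs T := (CFC.abs_nonneg T).isSelfAdjoint
  have h : star (CFC.abs T) * CFC.abs T = star T * T := by rw [hsa, CFC.abs_mul_abs]
  have key : ∀ S : H →L[ℂ] H, inner ℂ ((star S * S) x) x = ((‖S x‖ ^ 2 : ℝ) : ℂ) := by
    intro S
    change inner ℂ (ContinuousLinearMap.adjoint S (S x)) x = _
    rw [ContinuousLinearMap.adjoint_inner_left, inner_self_eq_norm_sq_to_K]
    simp
  have h2 := key (CFC.abs T)
  rw [h, key T] at h2
  have h3 : ‖T x‖ ^ 2 = ‖CFC.abs T x‖ ^ 2 := by exact_mod_cast h2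
  exact ((sq_eq_sq₀ (norm_nonneg _) (norm_nonneg _)).1 h3).symm

/-- The closure of the range of `|T|` has the kernel of `T` as its orthogonal complement. -/
theorem orthogonal_closure_range_cfcAbs (T : H →L[ℂ] H) :
    (LinearMap.range (CFC.abs T).toLinearMap).topologicalClosureᗮ =
      LinearMap.ker T.toLinearMap := by
  have hsa : ContinuousLinearMap.adjoint (CFC.abs T) = CFC.abs T :=
    (CFC.abs_nonneg T).isSelfAdjoint
  rw [Submodule.orthogonal_closure, ContinuousLinearMap.orthogonal_range, hsa]
  ext x
  simp only [LinearMap.mem_ker, ContinuousLinearMap.coe_coe]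
  rw [← norm_eq_zero, norm_cfcAbs_apply, norm_eq_zero]

/-- Every bounded operator on a Hilbert space has exactly one polar decomposition. -/
theorem existsUnique_isPolarDecomposition (T : H →L[ℂ] H) :
    ∃! U : H →L[ℂ] H, IsPolarDecomposition T U := by
  set A := CFC.abs T with hA
  set K := (LinearMap.range A.toLinearMap).topologicalClosure with hK
  have hKo : Kᗮ = LinearMap.ker T.toLinearMap := orthogonal_closure_range_cfcAbs T
  have hKc : IsClosed (K : Set H) := Submodule.isClosed_topologicalClosure _
  have : CompleteSpace K := hKc.completeSpace_coe
  have hAK : ∀ x, A x ∈ K := fun x =>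
    Submodule.le_topologicalClosure _ (LinearMap.mem_range_self A.toLinearMap x)
  let e : H →ₗ[ℂ] K := A.toLinearMap.codRestrict K hAK
  have hed : DenseRange e := by
    intro y
    rw [closure_subtype]
    have hy : (y : H) ∈ closure (Set.range A) := y.2
    refine closure_mono ?_ hy
    rintro _ ⟨x, rfl⟩
    exact ⟨e x, ⟨x, rfl⟩, rfl⟩
  have hen : ∀ x, ‖e x‖ = ‖T x‖ := fun x => norm_cfcAbs_apply T x
  let V : K →L[ℂ] H := T.toLinearMap.extendOfNorm e
  have hVe : ∀ x, V (e x) = T x := fun x =>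
    LinearMap.extendOfNorm_eq hed ⟨1, fun x => by rw [one_mul, hen]; rfl⟩ x
  have hVn : ∀ k, ‖V k‖ = ‖k‖ := by
    intro k
    induction k using hed.induction_on with
    | hp => exact isClosed_eq (by fun_prop) (by fun_prop)
    | ih x => rw [hVe, hen]
  let U : H →L[ℂ] H := V ∘L K.orthogonalProjectionOnto
  have hUn : ∀ x, ‖U x‖ = ‖K.orthogonalProjectionOnto x‖ := fun x => hVn _
  have hker : LinearMap.ker U.toLinearMap = Kᗮ := by
    ext x
    rw [LinearMap.mem_ker, ContinuousLinearMap.coe_coe, ← norm_eq_zero, hUn, norm_eq_zero,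
      Submodule.orthogonalProjectionOnto_eq_zero_iff]
  have hKoo : Kᗮᗮ = K := Submodule.orthogonal_orthogonal K
  refine ⟨U, ⟨?_, ?_, ?_⟩, ?_⟩
  · ext x
    have : K.orthogonalProjectionOnto (A x) = e x :=
      Submodule.orthogonalProjectionOnto_mem_subspace_eq_self (e x)
    change V (K.orthogonalProjectionOnto (A x)) = T x
    rw [this, hVe]
  · intro x hx
    rw [hker, hKoo] at hx
    rw [hUn]
    exact congrArg norm (Submodule.orthogonalProjectionOnto_mem_subspace_eq_self (⟨x, hx⟩ : K))
  · rw [hker, hKo]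
  · intro W hW
    have hWA : ∀ x, W (A x) = T x := fun x => DFunLike.congr_fun hW.mul_abs x
    have hWV : ∀ k : K, W k = V k := by
      intro k
      induction k using hed.induction_on with
      | hp => exact isClosed_eq (by fun_prop) (by fun_prop)
      | ih x => rw [hVe]; exact hWA x
    ext x
    have hx : x - K.orthogonalProjectionOnto x ∈ LinearMap.ker W.toLinearMap := by
      rw [hW.ker_eq, ← hKo]
      exact Submodule.sub_starProjection_mem_orthogonal x
    have h0 : W (x - K.orthogonalProjectionOnto x) = 0 := hx
    rw [map_sub, sub_eq_zero] at h0
    rw [h0, hWV]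
    rfl

/-- The partial isometry `U` of the polar decomposition `T = U |T|`. -/
noncomputable def polarIsometry (T : H →L[ℂ] H) : H →L[ℂ] H :=
  (existsUnique_isPolarDecomposition T).choose

theorem isPolarDecomposition_polarIsometry (T : H →L[ℂ] H) :
    IsPolarDecomposition T (polarIsometry T) :=
  (existsUnique_isPolarDecomposition T).choose_spec.1

/-- The `t`-Aluthge transform `|T|^t U |T|^(1-t)`, where `T = U |T|` is the polar decomposition.
Powers of the positive operator `|T|` are taken in the continuous functional calculus, so that
`|T|^0` is the identity. -/
noncomputable def aluthgeTransform (t : ℝ) (T : H →L[ℂ] H) : H →L[ℂ] H :=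
  CFC.abs T ^ t * polarIsometry T * CFC.abs T ^ (1 - t)

/-- The positive operator `P_t = |T|^(2(1-t)) + |T|^(2t)`. -/
noncomputable def aluthgeSum (t : ℝ) (T : H →L[ℂ] H) : H →L[ℂ] H :=
  CFC.abs T ^ (2 * (1 - t)) + CFC.abs T ^ (2 * t)

end NumericalRadiusDefs

section NumericalRadius

open ContinuousLinearMap

variable {H : Type*} [NormedAddCommGroup H] [InnerProductSpace ℂ H]

/-! Write `B = |T|^t`, `C = |T|^(1-t)`, `S = B U C`, `P = B² + C²`, so that `T = U C B`. For unit
`x` and a unimodular `z` rotating `⟨Tx, x⟩` onto its modulus, polarization gives `4|⟨Tx, x⟩| ≤ ‖F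
x‖² ≤ ‖F F*‖` with `F = zB + C U*`, and `F F* ≤ P + R` where `R = zS + (zS)*`
(`exists_norm_inner_le_norm_aluthgeSum_add`). Squaring `P + R` produces `P²`, `R²` and `RP + PR`;
the last two are controlled by numerical radii, since `RP + PR` is again twice a real part
(`sq_norm_add_smul_add_star_smul_le`). The second bound completes the square through `w(SP + PS) ≤
2‖P‖w(S)`. -/

theorem norm_inner_apply_le_numericalRadius (S : H →L[ℂ] H) {x : H} (hx : ‖x‖ = 1) :
    ‖inner ℂ (S x) x‖ ≤ numericalRadius S := by
  refine le_csSup ⟨‖S‖, ?_⟩ ⟨x, hx, rfl⟩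
  rintro r ⟨y, hy, rfl⟩
  calc ‖inner ℂ (S y) y‖ ≤ ‖S y‖ * ‖y‖ := norm_inner_le_norm _ _
    _ ≤ ‖S‖ * ‖y‖ * ‖y‖ := by gcongr; exact S.le_opNorm y
    _ = ‖S‖ := by rw [hy, mul_one, mul_one]

theorem numericalRadius_nonneg (S : H →L[ℂ] H) : 0 ≤ numericalRadius S := by
  refine Real.sSup_nonneg ?_
  rintro r ⟨y, -, rfl⟩
  exact norm_nonneg _

theorem numericalRadius_le {S : H →L[ℂ] H} {C : ℝ} (hC : 0 ≤ C)
    (h : ∀ x : H, ‖x‖ = 1 → ‖inner ℂ (S x) x‖ ≤ C) : numericalRadius S ≤ C := by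
  refine Real.sSup_le ?_ hC
  rintro r ⟨y, hy, rfl⟩
  exact h y hy

theorem norm_inner_apply_le_numericalRadius_mul_sq (S : H →L[ℂ] H) (x : H) :
    ‖inner ℂ (S x) x‖ ≤ numericalRadius S * ‖x‖ ^ 2 := by
  rcases eq_or_ne x 0 with rfl | hx
  · simp
  have hn : ‖x‖ ≠ 0 := norm_ne_zero_iff.2 hx
  have hu : ‖((‖x‖⁻¹ : ℝ) : ℂ) • x‖ = 1 := by
    rw [norm_smul, Complex.norm_real, norm_inv, norm_norm, inv_mul_cancel₀ hn]
  have h := norm_inner_apply_le_numericalRadius S hu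
  rw [map_smul, inner_smul_left, inner_smul_right, norm_mul, norm_mul, RCLike.norm_conj,
    Complex.norm_real, norm_inv, norm_norm] at h
  calc ‖inner ℂ (S x) x‖ = ‖x‖⁻¹ * (‖x‖⁻¹ * ‖inner ℂ (S x) x‖) * ‖x‖ ^ 2 := by
        field_simp
    _ ≤ _ := by gcongr

theorem numericalRadius_smul (c : ℂ) (S : H →L[ℂ] H) :
    numericalRadius (c • S) = ‖c‖ * numericalRadius S := by
  rw [numericalRadius, numericalRadius, ← smul_eq_mul, ← Real.sSup_smul_of_nonneg (norm_nonneg c)]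
  congr 1
  ext r
  simp only [Set.mem_smul_set, Set.mem_ofPred_eq]
  constructor
  · rintro ⟨x, hx, rfl⟩
    exact ⟨_, ⟨x, hx, rfl⟩, by simp [mul_comm]⟩
  · rintro ⟨_, ⟨x, hx, rfl⟩, rfl⟩
    exact ⟨x, hx, by simp [mul_comm]⟩

/-- Every complex number is rotated onto its norm by a unimodular factor acting through the
first slot of the inner product. -/
theorem exists_norm_eq_one_inner_smul_left (u v : H) :
    ∃ z : ℂ, ‖z‖ = 1 ∧ inner ℂ (z • u) v = (‖inner ℂ u v‖ : ℂ) := by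
  obtain ⟨c, hc, h⟩ := RCLike.exists_norm_eq_mul_self (inner ℂ u v)
  -- The inner product is conjugate-linear in its first slot, hence the conjugate.
  refine ⟨starRingEnd ℂ c, by rw [RCLike.norm_conj, hc], ?_⟩
  rw [inner_smul_left, Complex.conj_conj]
  exact h.symm

/-- Polarization with the term `‖u - v‖²` dropped. -/
theorem four_mul_re_inner_le_sq_norm_add (u v : H) :
    4 * (inner ℂ u v).re ≤ ‖u + v‖ ^ 2 := by
  have h1 := norm_add_sq (𝕜 := ℂ) u v
  have h2 := norm_sub_sq (𝕜 := ℂ) u v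
  have h3 := sq_nonneg ‖u - v‖
  simp only [RCLike.re_to_complex] at h1 h2
  linarith

variable [CompleteSpace H]

theorem re_inner_add_star_apply (S : H →L[ℂ] H) (x : H) :
    (inner ℂ ((S + star S) x) x).re = 2 * (inner ℂ (S x) x).re := by
  have h : inner ℂ (star S x) x = inner ℂ x (S x) := adjoint_inner_left S x x
  have h2 : (inner ℂ x (S x)).re = (inner ℂ (S x) x).re := inner_re_symm (𝕜 := ℂ) x (S x)
  rw [add_apply, inner_add_left, h, Complex.add_re, h2, two_mul]

/-- A self-adjoint operator has norm equal to the supremum of its absolute Rayleigh quotients, here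
twice real parts of rotated values of the form of `S`. -/
theorem norm_smul_add_star_smul_le (S : H →L[ℂ] H) {z : ℂ} (hz : ‖z‖ = 1) :
    ‖z • S + star (z • S)‖ ≤ 2 * numericalRadius S := by
  have hw := numericalRadius_nonneg S
  have hsa : IsSelfAdjoint (z • S + star (z • S)) := IsSelfAdjoint.add_star_self _
  rw [norm_eq_iSup_rayleighQuotient _ hsa.isSymmetric]
  refine Real.iSup_le (fun x => ?_) (by positivity)
  have h : |(z • S + star (z • S)).reApplyInnerSelf x| ≤ 2 * numericalRadius S * ‖x‖ ^ 2 := by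
    rw [reApplyInnerSelf_apply]
    change |(inner ℂ _ _).re| ≤ _
    rw [re_inner_add_star_apply, abs_mul, abs_two, mul_assoc]
    gcongr
    refine (Complex.abs_re_le_norm _).trans ?_
    rw [smul_apply, inner_smul_left, norm_mul, RCLike.norm_conj, hz, one_mul]
    exact norm_inner_apply_le_numericalRadius_mul_sq S x
  rw [rayleighQuotient, abs_div, abs_sq]
  exact div_le_of_le_mul₀ (sq_nonneg _) (by positivity) h

theorem numericalRadius_le_of_norm_smul_add_star_smul_le {S : H →L[ℂ] H} {C : ℝ} (hC : 0 ≤ C)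
    (h : ∀ z : ℂ, ‖z‖ = 1 → ‖z • S + star (z • S)‖ ≤ 2 * C) : numericalRadius S ≤ C := by
  refine numericalRadius_le hC fun x hx => ?_
  obtain ⟨z, hz, hzx⟩ := exists_norm_eq_one_inner_smul_left (S x) x
  have h1 : (inner ℂ ((z • S + star (z • S)) x) x).re = 2 * ‖inner ℂ (S x) x‖ := by
    rw [re_inner_add_star_apply, smul_apply, hzx, Complex.ofReal_re]
  have h2 : (inner ℂ ((z • S + star (z • S)) x) x).re ≤ 2 * C :=
    calc _ ≤ ‖inner ℂ ((z • S + star (z • S)) x) x‖ := Complex.re_le_norm _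
      _ ≤ ‖(z • S + star (z • S)) x‖ * ‖x‖ := norm_inner_le_norm _ _
      _ ≤ ‖z • S + star (z • S)‖ * ‖x‖ * ‖x‖ := by gcongr; exact le_opNorm _ x
      _ ≤ 2 * C := by rw [hx, mul_one, mul_one]; exact h z hz
  linarith

/-- Anticommuting with a self-adjoint operator commutes with taking real parts. -/
theorem smul_anticommutator_add_star {P : H →L[ℂ] H} (hP : IsSelfAdjoint P) (S : H →L[ℂ] H)
    (z : ℂ) :
    z • (S * P + P * S) + star (z • (S * P + P * S)) =
      (z • S + star (z • S)) * P + P * (z • S + star (z • S)) := by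
  simp only [star_smul, star_add, star_mul, hP.star_eq, smul_add, add_mul, mul_add,
    smul_mul_assoc, mul_smul_comm]
  abel

/-- For self-adjoint `P`, the numerical radius of `S P + P S` is at most `2 ‖P‖ w(S)`. -/
theorem numericalRadius_anticommutator_le {P : H →L[ℂ] H} (hP : IsSelfAdjoint P)
    (S : H →L[ℂ] H) :
    numericalRadius (S * P + P * S) ≤ 2 * ‖P‖ * numericalRadius S := by
  have hw := numericalRadius_nonneg S
  refine numericalRadius_le_of_norm_smul_add_star_smul_le (by positivity) fun z hz => ?_
  -- Passing to real parts gives `‖R‖ ≤ 2 w(S)`; bounding by `‖S‖ ≤ 2 w(S)` directly would lose a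
  -- factor of 2.
  rw [smul_anticommutator_add_star hP]
  have hR := norm_smul_add_star_smul_le S hz
  set R := z • S + star (z • S)
  calc ‖R * P + P * R‖ ≤ ‖R * P‖ + ‖P * R‖ := norm_add_le _ _
    _ ≤ ‖R‖ * ‖P‖ + ‖P‖ * ‖R‖ := add_le_add (norm_mul_le _ _) (norm_mul_le _ _)
    _ = 2 * ‖P‖ * ‖R‖ := by ring
    _ ≤ 2 * ‖P‖ * (2 * numericalRadius S) := by gcongr
    _ = _ := by ring

theorem sq_norm_add_smul_add_star_smul_le {P : H →L[ℂ] H} (hP : IsSelfAdjoint P)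
    (S : H →L[ℂ] H) {z : ℂ} (hz : ‖z‖ = 1) :
    ‖P + (z • S + star (z • S))‖ ^ 2 ≤
      ‖P‖ ^ 2 + 4 * numericalRadius S ^ 2 + 2 * numericalRadius (S * P + P * S) := by
  have hR := norm_smul_add_star_smul_le S hz
  have hQ := norm_smul_add_star_smul_le (S * P + P * S) hz
  rw [smul_anticommutator_add_star hP] at hQ
  have hRsa : IsSelfAdjoint (z • S + star (z • S)) := IsSelfAdjoint.add_star_self _
  set R := z • S + star (z • S)
  calc ‖P + R‖ ^ 2 = ‖(P + R) * (P + R)‖ := by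
        rw [sq, ← CStarRing.norm_star_mul_self, (hP.add hRsa).star_eq]
    _ = ‖P * P + R * R + (R * P + P * R)‖ := by congr 1; noncomm_ring
    _ ≤ ‖P * P‖ + ‖R * R‖ + ‖R * P + P * R‖ := norm_add₃_le
    _ ≤ ‖P‖ * ‖P‖ + ‖R‖ * ‖R‖ + ‖R * P + P * R‖ := by gcongr <;> exact norm_mul_le _ _
    _ ≤ ‖P‖ * ‖P‖ + (2 * numericalRadius S) * (2 * numericalRadius S)
          + 2 * numericalRadius (S * P + P * S) := by
        have hw := numericalRadius_nonneg S
        gcongr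
    _ = _ := by ring

/-- Nonnegative exponents keep the powers continuous at `0` and the scalar law valid there, so `a`
need not be invertible. -/
theorem CFC.rpow_add_of_nonneg {A : Type*} [CStarAlgebra A] [PartialOrder A] [StarOrderedRing A]
    (a : A) {x y : ℝ} (hx : 0 ≤ x) (hy : 0 ≤ y) : a ^ (x + y) = a ^ x * a ^ y := by
  simp only [CFC.rpow_def]
  rw [← cfc_mul _ _ a (NNReal.continuous_rpow_const hx).continuousOn
    (NNReal.continuous_rpow_const hy).continuousOn]
  exact cfc_congr fun z _ => NNReal.rpow_add_of_nonneg z hx hy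

theorem IsPolarDecomposition.norm_apply_le {T U : H →L[ℂ] H} (h : IsPolarDecomposition T U)
    (x : H) : ‖U x‖ ≤ ‖x‖ := by
  set K := LinearMap.ker U.toLinearMap
  have : CompleteSpace K := U.isClosed_ker.completeSpace_coe
  obtain ⟨p, hp, q, hq, rfl⟩ := K.exists_add_mem_mem_orthogonal x
  have hUp : U p = 0 := hp
  have hpq : ‖p + q‖ * ‖p + q‖ = ‖p‖ * ‖p‖ + ‖q‖ * ‖q‖ :=
    norm_add_sq_eq_norm_sq_add_norm_sq_of_inner_eq_zero (𝕜 := ℂ) p q (hq p hp)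
  rw [map_add, hUp, zero_add, h.norm_map q hq]
  nlinarith [norm_nonneg p, norm_nonneg q, norm_nonneg (p + q)]

theorem IsPolarDecomposition.star_mul_self_le_one {T U : H →L[ℂ] H}
    (h : IsPolarDecomposition T U) : star U * U ≤ 1 := by
  have hU : ‖U‖ ≤ 1 := U.opNorm_le_bound zero_le_one fun x => by
    rw [one_mul]; exact h.norm_apply_le x
  rw [← CStarAlgebra.norm_le_one_iff_of_nonneg _ (star_mul_self_nonneg U),
    CStarRing.norm_star_mul_self]
  exact mul_le_one₀ hU (norm_nonneg _) hU

theorem isSelfAdjoint_aluthgeSum (t : ℝ) (T : H →L[ℂ] H) : IsSelfAdjoint (aluthgeSum t T) :=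
  (add_nonneg CFC.rpow_nonneg CFC.rpow_nonneg).isSelfAdjoint

theorem exists_norm_inner_le_norm_aluthgeSum_add {t : ℝ} (ht0 : 0 ≤ t) (ht1 : t ≤ 1)
    (T : H →L[ℂ] H) {x : H} (hx : ‖x‖ = 1) :
    ∃ z : ℂ, ‖z‖ = 1 ∧ 4 * ‖inner ℂ (T x) x‖ ≤
      ‖aluthgeSum t T + (z • aluthgeTransform t T + star (z • aluthgeTransform t T))‖ := by
  obtain ⟨z, hz, hzx⟩ := exists_norm_eq_one_inner_smul_left (T x) x
  refine ⟨z, hz, ?_⟩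
  have hpol := isPolarDecomposition_polarIsometry T
  have ht1' : 0 ≤ 1 - t := sub_nonneg.2 ht1
  rw [aluthgeSum, aluthgeTransform]
  set U := polarIsometry T
  have hA0 : 0 ≤ CFC.abs T := CFC.abs_nonneg T
  have hP1 : CFC.abs T ^ (2 * (1 - t)) = CFC.abs T ^ (1 - t) * CFC.abs T ^ (1 - t) := by
    rw [two_mul, CFC.rpow_add_of_nonneg _ ht1' ht1']
  have hP2 : CFC.abs T ^ (2 * t) = CFC.abs T ^ t * CFC.abs T ^ t := by
    rw [two_mul, CFC.rpow_add_of_nonneg _ ht0 ht0]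
  have hT : T = U * CFC.abs T ^ (1 - t) * CFC.abs T ^ t := by
    rw [mul_assoc, ← CFC.rpow_add_of_nonneg _ ht1' ht0, sub_add_cancel, CFC.rpow_one _ hA0,
      hpol.mul_abs]
  rw [hP1, hP2]
  have hB : star (CFC.abs T ^ t) = CFC.abs T ^ t :=
    (CFC.rpow_nonneg (a := CFC.abs T) (y := t)).isSelfAdjoint.star_eq
  have hC : star (CFC.abs T ^ (1 - t)) = CFC.abs T ^ (1 - t) :=
    (CFC.rpow_nonneg (a := CFC.abs T) (y := 1 - t)).isSelfAdjoint.star_eq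
  generalize CFC.abs T ^ t = B at *
  generalize CFC.abs T ^ (1 - t) = C at *
  set F : H →L[ℂ] H := z • B + C * star U with hF
  have hzz : z * star z = 1 := by
    rw [← starRingEnd_apply, Complex.mul_conj, Complex.normSq_eq_norm_sq, hz]; norm_num
  -- `F F*` contains `C U* U C` instead of `C²`; the added term is this defect, nonnegative because
  -- `U* U ≤ 1`.
  have hFF : F * star F + star C * (1 - star U * U) * C =
      C * C + B * B + (z • (B * U * C) + star (z • (B * U * C))) := by
    simp only [hF, star_add, star_smul, star_mul, star_star, hB, hC, mul_add, add_mul,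
      smul_mul_assoc, mul_smul_comm, mul_sub, sub_mul, mul_one, mul_assoc, smul_add]
    rw [smul_smul, mul_comm (star z) z, hzz, one_smul]
    abel
  have hle : F * star F ≤ C * C + B * B + (z • (B * U * C) + star (z • (B * U * C))) := by
    rw [← hFF, le_add_iff_nonneg_right]
    exact star_left_conjugate_nonneg (sub_nonneg.2 hpol.star_mul_self_le_one) C
  have hinner : inner ℂ (z • T x) x = inner ℂ (z • B x) ((C * star U) x) := by
    have h1 : C * star U = adjoint (U * C) := by
      rw [← star_eq_adjoint, star_mul, hC]
    rw [h1, adjoint_inner_right, map_smul]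
    conv_lhs => rw [hT]
    rfl
  calc 4 * ‖inner ℂ (T x) x‖ = 4 * (inner ℂ (z • B x) ((C * star U) x)).re := by
        rw [← hinner, hzx, Complex.ofReal_re]
    _ ≤ ‖z • B x + (C * star U) x‖ ^ 2 := four_mul_re_inner_le_sq_norm_add _ _
    _ = ‖F x‖ ^ 2 := rfl
    _ ≤ ‖F‖ ^ 2 := by
        gcongr
        simpa [hx] using F.le_opNorm x
    _ = ‖F * star F‖ := by rw [CStarRing.norm_self_mul_star, sq]
    _ ≤ _ := CStarAlgebra.norm_le_norm_of_nonneg_of_le (mul_star_self_nonneg F) hle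

theorem numericalRadius_le_sqrt_aluthge {t : ℝ} (ht0 : 0 ≤ t) (ht1 : t ≤ 1) (T : H →L[ℂ] H) :
    numericalRadius T ≤
      √((1 / 16) * ‖aluthgeSum t T‖ ^ 2 + (1 / 4) * numericalRadius (aluthgeTransform t T) ^ 2
        + (1 / 8) * numericalRadius
            (aluthgeTransform t T * aluthgeSum t T + aluthgeSum t T * aluthgeTransform t T)) := by
  refine numericalRadius_le (Real.sqrt_nonneg _) fun x hx => Real.le_sqrt_of_sq_le ?_
  obtain ⟨z, hz, h⟩ := exists_norm_inner_le_norm_aluthgeSum_add ht0 ht1 T hx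
  have h1 := sq_norm_add_smul_add_star_smul_le (isSelfAdjoint_aluthgeSum t T)
    (aluthgeTransform t T) hz
  have h2 := pow_le_pow_left₀ (by positivity) h 2
  linarith

theorem sqrt_aluthge_le (t : ℝ) (T : H →L[ℂ] H) :
    √((1 / 16) * ‖aluthgeSum t T‖ ^ 2 + (1 / 4) * numericalRadius (aluthgeTransform t T) ^ 2
        + (1 / 8) * numericalRadius
            (aluthgeTransform t T * aluthgeSum t T + aluthgeSum t T * aluthgeTransform t T)) ≤
      (1 / 4) * ‖aluthgeSum t T‖ + (1 / 2) * numericalRadius (aluthgeTransform t T) := by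
  have hw := numericalRadius_nonneg (aluthgeTransform t T)
  have h := numericalRadius_anticommutator_le (isSelfAdjoint_aluthgeSum t T)
    (aluthgeTransform t T)
  refine Real.sqrt_le_iff.2 ⟨by positivity, ?_⟩
  -- The right side squared has cross term `‖P‖ w(S) / 4`, exactly `1/8` of the anticommutator
  -- bound.
  linarith

theorem aluthgeSum_half (T : H →L[ℂ] H) : aluthgeSum (1 / 2) T = (2 : ℂ) • CFC.abs T := by
  rw [aluthgeSum, show (2 : ℝ) * (1 - 1 / 2) = 1 by norm_num,
    show (2 : ℝ) * (1 / 2) = 1 by norm_num, CFC.rpow_one _ (CFC.abs_nonneg T), two_smul]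

end NumericalRadius

theorem corollary3p3 {H : Type*} [NormedAddCommGroup H] [InnerProductSpace ℂ H] [CompleteSpace H]
    (T : H →L[ℂ] H) :
    (∀ t : ℝ, 0 ≤ t → t ≤ 1 →
      numericalRadius T ≤
          √((1 / 16) * ‖aluthgeSum t T‖ ^ 2 + (1 / 4) * numericalRadius (aluthgeTransform t T) ^ 2
            + (1 / 8) * numericalRadius
                (aluthgeTransform t T * aluthgeSum t T + aluthgeSum t T * aluthgeTransform t T)) ∧
      √((1 / 16) * ‖aluthgeSum t T‖ ^ 2 + (1 / 4) * numericalRadius (aluthgeTransform t T) ^ 2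
            + (1 / 8) * numericalRadius
                (aluthgeTransform t T * aluthgeSum t T + aluthgeSum t T * aluthgeTransform t T)) ≤
          (1 / 4) * ‖aluthgeSum t T‖ + (1 / 2) * numericalRadius (aluthgeTransform t T)) ∧
    (numericalRadius T ≤
        √((1 / 4) * ‖T‖ ^ 2 + (1 / 4) * numericalRadius (aluthgeTransform (1 / 2) T) ^ 2
          + (1 / 4) * numericalRadius
              (aluthgeTransform (1 / 2) T * CFC.abs T + CFC.abs T * aluthgeTransform (1 / 2) T)) ∧
      √((1 / 4) * ‖T‖ ^ 2 + (1 / 4) * numericalRadius (aluthgeTransform (1 / 2) T) ^ 2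
          + (1 / 4) * numericalRadius
              (aluthgeTransform (1 / 2) T * CFC.abs T + CFC.abs T * aluthgeTransform (1 / 2) T)) ≤
        (1 / 2) * ‖T‖ + (1 / 2) * numericalRadius (aluthgeTransform (1 / 2) T)) := by
  have main : ∀ t : ℝ, 0 ≤ t → t ≤ 1 → _ := fun t ht0 ht1 =>
    And.intro (numericalRadius_le_sqrt_aluthge ht0 ht1 T) (sqrt_aluthge_le t T)
  refine ⟨main, ?_⟩
  have hn : ‖aluthgeSum (1 / 2) T‖ = 2 * ‖T‖ := by
    rw [aluthgeSum_half, norm_smul, CFC.norm_abs, Complex.norm_two]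
  have hq : numericalRadius (aluthgeTransform (1 / 2) T * aluthgeSum (1 / 2) T +
      aluthgeSum (1 / 2) T * aluthgeTransform (1 / 2) T) =
      2 * numericalRadius
        (aluthgeTransform (1 / 2) T * CFC.abs T + CFC.abs T * aluthgeTransform (1 / 2) T) := by
    rw [aluthgeSum_half, mul_smul_comm, smul_mul_assoc, ← smul_add, numericalRadius_smul,
      Complex.norm_two]
  have h := main (1 / 2) (by norm_num) (by norm_num)
  rw [hn, hq] at h
  convert h using 3 <;> ring
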